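/- Let $d\ge 1$ and let $\mu$ be a probability distribution on $\mathbb{Z}^d$, regarded as a Borel probability measure on $\mathbb{R}^d$ with $\mu(\mathbb{R}^d\setminus\mathbb{Z}^d)=0$. For a probability measure $\rho$ on $\mathbb{R}^d$ write $\widehat\rho(z)=\int_{\mathbb{R}^d} e^{i\langle z,x\rangle}\,\rho(dx)$, $z\in\mathbb{R}^d$, for its characteristic function. Call $\rho$ infinitely divisible if for every $n\ge 1$ there is a probability measure $\rho_n$ on $\mathbb{R}^d$ whose $n$-fold convolution with itself is $\rho$. Call $\rho$ compound Poisson with jump size distribution $\sigma$, where $\sigma$ is a probability measure on $\mathbb{R}^d\setminus\{0\}$, if $\widehat\rho(z)=\exp\left(\int_{\mathbb{R}^d}(e^{i\langle z,x\rangle}-1)\,\lambda\,\sigma(dx)\right)$ for all $z\in\mathbb{R}^d$ with some $\lambda>0$. Then the following are equivalent: (i) $\widehat\mu(z)\neq 0$ for all $z\in\mathbb{R}^d$. (ii) There exist $k\in\mathbb{Z}^d$ and a finite signed measure $\nu$ on $\mathbb{R}^d$ with support contained in $\mathbb{Z}^d\setminus\{0\}$ such that $$\widehat\mu(z)=\exp\left(i\langle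 k,z\rangle+\int_{\mathbb{R}^d}\left(e^{i\langle z,x\rangle}-1\right)\nu(dx)\right)\quad\text{for all } z\in\mathbb{R}^d.$$ (iii) There exist $k\in\mathbb{Z}^d$ and two compound Poisson distributions $\mu_1$ and $\mu_2$ with jump size distributions supported in $\mathbb{Z}^d\setminus\{0\}$ such that $\widehat\mu(z)=e^{i\langle k,z\rangle}\,\widehat\mu_1(z)/\widehat\mu_2(z)$ for all $z\in\mathbb{R}^d$. (iv) There exist two infinitely divisible distributions $\mu_3$ and $\mu_4$ on $\mathbb{R}^d$ such that $\widehat\mu(z)=\widehat\mu_3(z)/\widehat\mu_4(z)$ for all $z\in\mathbb{R}^d$. In other words, calling a probability distribution on $\mathbb{R}^d$ quasi-infinitely divisible if its characteristic function is the quotient of the characteristic functions of two infinitely divisible distributions, $\mu$ is quasi-infinitely divisible if and only if its characteristic function has no zeros. -/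

import Mathlib

open MeasureTheory
open scoped NNReal ENNReal RealInnerProductSpace

noncomputable section

/-- The integer vector `k`, seen as a point of `ℝ^d` (with its Euclidean structure). -/
def intVec {d : ℕ} (k : Fin d → ℤ) : EuclideanSpace ℝ (Fin d) :=
  WithLp.toLp 2 (fun i => (k i : ℝ))

/-- The lattice `ℤ^d` as a subset of `ℝ^d`. -/
def intLattice (d : ℕ) : Set (EuclideanSpace ℝ (Fin d)) :=
  Set.range (intVec (d := d))

/-- The `n`-fold convolution of a measure with itself; the `0`-fold one is `δ₀`. -/
def convPow {d : ℕ} (ρ : Measure (EuclideanSpace ℝ (Fin d))) :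
    ℕ → Measure (EuclideanSpace ℝ (Fin d))
  | 0 => Measure.dirac 0
  | n + 1 => (convPow ρ n).conv ρ

/-- A probability distribution `ρ` on `ℝ^d` is infinitely divisible if for every `n ≥ 1` it is the
`n`-fold convolution of some probability distribution with itself. -/
def IsInfinitelyDivisible {d : ℕ} (ρ : Measure (EuclideanSpace ℝ (Fin d))) : Prop :=
  IsProbabilityMeasure ρ ∧
    ∀ n : ℕ, 1 ≤ n → ∃ ρn : Measure (EuclideanSpace ℝ (Fin d)),
      IsProbabilityMeasure ρn ∧ ρ = convPow ρn n

/-- A probability distribution on `ℝ^d` is quasi-infinitely divisible if its characteristic function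
is the quotient of the characteristic functions of two infinitely divisible distributions. -/
def IsQuasiInfinitelyDivisible {d : ℕ} (ρ : Measure (EuclideanSpace ℝ (Fin d))) : Prop :=
  IsProbabilityMeasure ρ ∧
    ∃ ρ₁ ρ₂ : Measure (EuclideanSpace ℝ (Fin d)),
      IsInfinitelyDivisible ρ₁ ∧ IsInfinitelyDivisible ρ₂ ∧
        ∀ z, charFun ρ z = charFun ρ₁ z / charFun ρ₂ z

/-- `ρ` is a compound Poisson distribution with jump size distribution `σ`, a probability measure
on `ℝ^d ∖ {0}`, and some jump rate `r > 0`. -/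
def IsCompoundPoisson {d : ℕ} (ρ σ : Measure (EuclideanSpace ℝ (Fin d))) : Prop :=
  IsProbabilityMeasure ρ ∧ IsProbabilityMeasure σ ∧ σ {0} = 0 ∧
    ∃ r : ℝ≥0, 0 < r ∧ ∀ z : EuclideanSpace ℝ (Fin d),
      charFun ρ z =
        Complex.exp (∫ x, (Complex.exp ((⟪z, x⟫ : ℝ) * Complex.I) - 1) ∂(r • σ))

end

/-!
The only deep implication is that a distribution `μ` on `ℤ^d` whose characteristic function has no
zeros has a signed Lévy measure. Rescaled by `2π`, the characteristic function is a function `F`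
on the torus `ℝ^d / ℤ^d` with absolutely convergent Fourier series, that is, an element of the
Wiener algebra (`WienerNormLE`). If `F` has no zeros, lifting it along `exp` on the covering space
`ℝ^d` gives `F = χ exp h` with a character `χ` and a continuous function `h` on the torus
(`exists_mFourier_mul_exp`). Let `p` be a trigonometric polynomial uniformly close to `h`. Then
`F χ⁻¹ exp (-p)` lies in the Wiener algebra and is uniformly close to `1`, so its logarithm is
given by the power series of `log`. This series converges in the Wiener algebra because the spectral
radius there is at most the sup norm (`WienerNormLE.exists_summable_pow`). The latter needs no
Gelfand theory: the Wiener norm of a trigonometric polynomial of degree `N` is at most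
`(2N + 1)^d` times its sup norm, and this factor is harmless for powers. Therefore `h` can be chosen
in the Wiener algebra (`WienerNormLE.exists_mFourier_mul_exp`).

The symmetry of `F` under reflection and conjugation allows the Fourier coefficients of `h` to be
taken real (`exists_charFun_eq_exp_tsum`); they are then the weights of the signed Lévy measure. Its
positive and negative parts, each enlarged by the same point mass, are Lévy measures of compound
Poisson distributions, which exist as Poisson mixtures of convolution powers
(`exists_charFun_eq_exp_integral`) and are infinitely divisible together with their shifts
(`isInfinitelyDivisible_of_charFun_eq`).

Conversely, the characteristic function of an infinitely divisible distribution has no zeros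
(`IsInfinitelyDivisible.charFun_ne_zero`): by the inequality `1 - |φ(2z)|² ≤ 4 (1 - |φ(z)|²)`
for its `n`-th roots, the set where it does not vanish is closed under doubling, and this
set is a neighbourhood of `0`.
-/

/-! ### Absolutely convergent series of characters in a Banach algebra -/

section AbsolutelyConvergent

variable {A : Type*} [NormedCommRing A] [NormedAlgebra ℂ A] {M : Type*} [Monoid M]

/-- `F` is the sum of a series `∑ₙ bₙ e(n)` whose coefficients have `ℓ¹` norm at most `C`. When `e`
runs through the characters of the torus, this says that `F` lies in the Wiener algebra and has
norm at most `C` there. -/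
def WienerNormLE (e : M →* A) (F : A) (C : ℝ) : Prop :=
  ∃ b : M → ℂ, Summable (fun n => ‖b n‖) ∧ ∑' n, ‖b n‖ ≤ C ∧ HasSum (fun n => b n • e n) F

namespace WienerNormLE

variable {e : M →* A} {F G : A} {C D : ℝ}

/-- The terms of the given series may repeat: collecting equal ones does not increase the
`ℓ¹` norm of the coefficients. -/
lemma of_hasSum {ι : Type*} {c : ι → ℂ} {φ : ι → M} (hc : Summable fun i => ‖c i‖)
    (hC : ∑' i, ‖c i‖ ≤ C) (hF : HasSum (fun i => c i • e (φ i)) F) :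
    WienerNormLE e F C := by
  let E := Equiv.sigmaFiberEquiv φ
  have hs : Summable fun p : (Σ n, {i // φ i = n}) => ‖c p.2‖ := E.summable_iff.2 hc
  have hfib : ∀ n, Summable fun i : {i // φ i = n} => ‖c i‖ := fun n => hs.sigma_factor n
  have hsum : Summable fun n => ∑' i : {i // φ i = n}, ‖c i‖ := hs.sigma
  have hle : ∀ n, ‖∑' i : {i // φ i = n}, c i‖ ≤ ∑' i : {i // φ i = n}, ‖c i‖ :=
    fun n => norm_tsum_le_tsum_norm (hfib n)
  have hb : Summable fun n => ‖∑' i : {i // φ i = n}, c i‖ :=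
    Summable.of_nonneg_of_le (fun _ => norm_nonneg _) hle hsum
  refine ⟨fun n => ∑' i : {i // φ i = n}, c i, hb, ?_, ?_⟩
  · calc _ ≤ ∑' n, ∑' i : {i // φ i = n}, ‖c i‖ := hb.tsum_le_tsum hle hsum
      _ = ∑' p : (Σ n, {i // φ i = n}), ‖c p.2‖ := (hs.tsum_sigma' hfib).symm
      _ = ∑' i, ‖c i‖ := E.tsum_eq (fun i => ‖c i‖)
      _ ≤ C := hC
  · have hF' : HasSum (fun p : (Σ n, {i // φ i = n}) => c p.2 • e (φ p.2)) F :=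
      (Equiv.hasSum_iff E (f := fun i => c i • e (φ i))).2 hF
    refine hF'.sigma fun n => ?_
    have h1 : HasSum (fun i : {i // φ i = n} => c i) (∑' i : {i // φ i = n}, c i) :=
      (hfib n).of_norm.hasSum
    convert h1.smul_const (e n) using 3 with i
    exact congrArg e i.2

lemma nonneg (h : WienerNormLE e F C) : 0 ≤ C := by
  obtain ⟨b, -, hC, -⟩ := h
  exact (tsum_nonneg fun _ => norm_nonneg _).trans hC

lemma mono (h : WienerNormLE e F C) (hCD : C ≤ D) : WienerNormLE e F D := by
  obtain ⟨b, hb, hC, hF⟩ := h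
  exact ⟨b, hb, hC.trans hCD, hF⟩

lemma norm_smul_le (he : ∀ m, ‖e m‖ ≤ 1) (a : ℂ) (m : M) : ‖a • e m‖ ≤ ‖a‖ := by
  rw [norm_smul]
  exact mul_le_of_le_one_right (norm_nonneg _) (he m)

lemma norm_le (he : ∀ m, ‖e m‖ ≤ 1) (h : WienerNormLE e F C) : ‖F‖ ≤ C := by
  obtain ⟨b, hb, hC, hF⟩ := h
  rw [← hF.tsum_eq]
  exact (tsum_of_norm_bounded hb.hasSum fun n => norm_smul_le he _ _).trans hC

lemma zero : WienerNormLE e 0 0 := ⟨0, by simp, by simp, by simp⟩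

lemma apply (m : M) : WienerNormLE e (e m) 1 := by
  refine of_hasSum (ι := Unit) (c := fun _ => 1) (φ := fun _ => m) (Summable.of_finite) (by simp) ?_
  simpa only [one_smul] using hasSum_unique (fun _ : Unit => e m)

lemma one : WienerNormLE e 1 1 := by simpa using apply (e := e) 1

lemma smul (h : WienerNormLE e F C) (a : ℂ) : WienerNormLE e (a • F) (‖a‖ * C) := by
  obtain ⟨b, hb, hC, hF⟩ := h
  refine ⟨fun n => a * b n, by simpa using hb.mul_left ‖a‖, ?_, ?_⟩
  · simp only [norm_mul, tsum_mul_left]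
    gcongr
  · simpa [mul_smul] using hF.const_smul a

lemma add (hF : WienerNormLE e F C) (hG : WienerNormLE e G D) :
    WienerNormLE e (F + G) (C + D) := by
  obtain ⟨b, hb, hC, hF⟩ := hF
  obtain ⟨c, hc, hD, hG⟩ := hG
  have hs : Summable fun n => ‖b n + c n‖ :=
    Summable.of_nonneg_of_le (fun _ => norm_nonneg _) (fun n => norm_add_le _ _) (hb.add hc)
  refine ⟨fun n => b n + c n, hs, ?_, ?_⟩
  · refine (hs.tsum_le_tsum (fun n => norm_add_le _ _) (hb.add hc)).trans ?_
    rw [hb.tsum_add hc]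
    gcongr
  · simpa [add_smul] using hF.add hG

lemma sum {ι : Type*} {s : Finset ι} {F : ι → A} {C : ι → ℝ}
    (h : ∀ i ∈ s, WienerNormLE e (F i) (C i)) : WienerNormLE e (∑ i ∈ s, F i) (∑ i ∈ s, C i) := by
  classical
  induction s using Finset.induction_on with
  | empty => simpa using zero
  | insert a s ha ih =>
    rw [Finset.sum_insert ha, Finset.sum_insert ha]
    exact (h a (by simp)).add (ih fun i hi => h i (by simp [hi]))

section Complete

variable [CompleteSpace A]

lemma mul (he : ∀ m, ‖e m‖ ≤ 1) (hF : WienerNormLE e F C) (hG : WienerNormLE e G D) :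
    WienerNormLE e (F * G) (C * D) := by
  have hC0 := hF.nonneg
  obtain ⟨b, hb, hC, hF⟩ := hF
  obtain ⟨c, hc, hD, hG⟩ := hG
  have hbF : Summable fun n => ‖b n • e n‖ :=
    Summable.of_nonneg_of_le (fun _ => norm_nonneg _) (fun n => norm_smul_le he _ _) hb
  have hcG : Summable fun n => ‖c n • e n‖ :=
    Summable.of_nonneg_of_le (fun _ => norm_nonneg _) (fun n => norm_smul_le he _ _) hc
  have hbc : Summable fun p : M × M => ‖b p.1 * c p.2‖ := by
    simpa using summable_mul_of_summable_norm hb.norm hc.norm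
  refine of_hasSum (ι := M × M) (c := fun p => b p.1 * c p.2) (φ := fun p => p.1 * p.2) hbc ?_ ?_
  · simp only [norm_mul]
    rw [← tsum_mul_tsum_of_summable_norm (f := fun n => ‖b n‖) (g := fun n => ‖c n‖) hb.norm
      hc.norm]
    exact mul_le_mul hC hD (tsum_nonneg fun _ => norm_nonneg _) hC0
  · have hs : Summable fun p : M × M => (b p.1 • e p.1) * (c p.2 • e p.2) :=
      summable_mul_of_summable_norm (f := fun n => b n • e n) (g := fun n => c n • e n) hbF hcG
    have h := hF.mul hG hs
    simp only [smul_mul_smul_comm] at h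
    simpa only [map_mul] using h

lemma pow (he : ∀ m, ‖e m‖ ≤ 1) (hF : WienerNormLE e F C) (n : ℕ) :
    WienerNormLE e (F ^ n) (C ^ n) := by
  induction n with
  | zero => simpa using one
  | succ n ih => simpa [pow_succ] using ih.mul he hF

/-- Completeness of the Wiener algebra. -/
lemma hasSum (he : ∀ m, ‖e m‖ ≤ 1) {F : ℕ → A} {K : ℕ → ℝ} (h : ∀ j, WienerNormLE e (F j) (K j))
    (hK : Summable K) (hG : HasSum F G) : WienerNormLE e G (∑' j, K j) := by
  choose b hb hC hF using h
  have hs : Summable fun p : (Σ _ : ℕ, M) => ‖b p.1 p.2‖ :=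
    (summable_sigma_of_nonneg fun _ => norm_nonneg _).2
      ⟨hb, Summable.of_nonneg_of_le (fun j => tsum_nonneg fun _ => norm_nonneg _) hC hK⟩
  refine of_hasSum (ι := Σ _ : ℕ, M) (c := fun p => b p.1 p.2) (φ := fun p => p.2) hs ?_ ?_
  · rw [hs.tsum_sigma]
    exact hs.sigma.tsum_le_tsum hC hK
  · have hs' : Summable fun p : (Σ _ : ℕ, M) => b p.1 p.2 • e p.2 :=
      Summable.of_norm_bounded hs fun p => norm_smul_le he _ _
    have h1 := hs'.hasSum
    have h2 := h1.sigma fun j => hF j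
    rwa [h2.unique hG] at h1

/-- A power series in an element of the Wiener algebra converges there as soon as the norms of the
powers are small enough. -/
lemma exists_powerSeries (he : ∀ m, ‖e m‖ ≤ 1) {u : A} {K : ℕ → ℝ} (a : ℕ → ℂ)
    (h : ∀ n, WienerNormLE e (u ^ n) (K n)) (hK : Summable fun n => ‖a n‖ * K n) :
    ∃ G D, WienerNormLE e G D ∧ HasSum (fun n => a n • u ^ n) G := by
  have hW : ∀ n, WienerNormLE e (a n • u ^ n) (‖a n‖ * K n) := fun n => (h n).smul (a n)
  have hs : Summable fun n => a n • u ^ n :=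
    Summable.of_norm_bounded hK fun n => (hW n).norm_le he
  exact ⟨_, _, hasSum he hW hK hs.hasSum, hs.hasSum⟩

end Complete

end WienerNormLE

end AbsolutelyConvergent

/-! ### Trigonometric polynomials and growth of powers -/

section TrigPoly

variable {A : Type*} [NormedCommRing A] [NormedAlgebra ℂ A]
  {d : Type*} [Fintype d]

/-- The frequencies `n ∈ ℤ^d` with `|nᵢ| ≤ N` for all `i`. -/
noncomputable def freqCube (d : Type*) [Fintype d] (N : ℕ) : Finset (Multiplicative (d → ℤ)) :=
  letI := Classical.decEq d
  (Fintype.piFinset fun _ : d => Finset.Icc (-(N : ℤ)) N).map Multiplicative.ofAdd.toEmbedding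

lemma mem_freqCube {N : ℕ} {m : Multiplicative (d → ℤ)} :
    m ∈ freqCube d N ↔ ∀ i, |m.toAdd i| ≤ N := by
  classical
  simp only [freqCube, Finset.mem_map_equiv, Fintype.mem_piFinset, Finset.mem_Icc, abs_le]
  rfl

lemma card_freqCube (N : ℕ) : (freqCube d N).card = (2 * N + 1) ^ Fintype.card d := by
  classical
  rw [freqCube, Finset.card_map, Fintype.card_piFinset]
  simp only [Int.card_Icc, Finset.prod_const, Finset.card_univ]
  congr 1
  omega

/-- Trigonometric polynomials of degree at most `N` in each variable. -/
noncomputable def trigPoly (e : Multiplicative (d → ℤ) →* A) (N : ℕ) : Submodule ℂ A :=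
  Submodule.span ℂ (e '' freqCube d N)

variable {e : Multiplicative (d → ℤ) →* A}

lemma one_mem_trigPoly : (1 : A) ∈ trigPoly e 0 :=
  Submodule.subset_span ⟨1, by simp [mem_freqCube], map_one e⟩

lemma mul_mem_trigPoly {p q : A} {N K : ℕ} (hp : p ∈ trigPoly e N) (hq : q ∈ trigPoly e K) :
    p * q ∈ trigPoly e (N + K) := by
  have h := Submodule.mul_mem_mul hp hq
  rw [trigPoly, trigPoly, Submodule.span_mul_span] at h
  refine Submodule.span_mono ?_ h
  rintro _ ⟨_, ⟨m, hm, rfl⟩, _, ⟨n, hn, rfl⟩, rfl⟩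
  refine ⟨m * n, ?_, map_mul e m n⟩
  simp only [Finset.mem_coe, mem_freqCube] at hm hn ⊢
  intro i
  push_cast
  exact (abs_add_le _ _).trans (add_le_add (hm i) (hn i))

lemma pow_mem_trigPoly {p : A} {N : ℕ} (hp : p ∈ trigPoly e N) (k : ℕ) :
    p ^ k ∈ trigPoly e (k * N) := by
  induction k with
  | zero => simpa using one_mem_trigPoly
  | succ k ih => rw [pow_succ, add_mul, one_mul]; exact mul_mem_trigPoly ih hp

lemma exists_finset_subset_freqCube (s : Finset (Multiplicative (d → ℤ))) :
    ∃ N, s ⊆ freqCube d N := by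
  refine ⟨∑ m ∈ s, ∑ i, (m.toAdd i).natAbs, fun m hm => mem_freqCube.2 fun i => ?_⟩
  rw [Int.abs_eq_natAbs]
  norm_cast
  calc (m.toAdd i).natAbs ≤ ∑ i, (m.toAdd i).natAbs :=
        Finset.single_le_sum (f := fun i => (m.toAdd i).natAbs) (fun _ _ => Nat.zero_le _)
          (Finset.mem_univ i)
    _ ≤ _ := Finset.single_le_sum (f := fun m : Multiplicative (d → ℤ) =>
        ∑ i, (m.toAdd i).natAbs) (fun _ _ => Nat.zero_le _) hm

lemma sum_mem_trigPoly {s : Finset (Multiplicative (d → ℤ))} {N : ℕ} (hs : s ⊆ freqCube d N)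
    (c : Multiplicative (d → ℤ) → ℂ) : ∑ m ∈ s, c m • e m ∈ trigPoly e N :=
  Submodule.sum_mem _ fun m hm =>
    Submodule.smul_mem _ _ (Submodule.subset_span ⟨m, hs hm, rfl⟩)

/-- The coefficients of a trigonometric polynomial are bounded by its sup norm, so its Wiener norm
exceeds the sup norm at most by a factor polynomial in the degree. -/
lemma wienerNormLE_of_mem_trigPoly
    (hcoeff : ∀ (s : Finset (Multiplicative (d → ℤ))) (c : Multiplicative (d → ℤ) → ℂ),
      ∀ m ∈ s, ‖c m‖ ≤ ‖∑ n ∈ s, c n • e n‖)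
    {p : A} {N : ℕ} (hp : p ∈ trigPoly e N) :
    WienerNormLE e p ((2 * N + 1 : ℝ) ^ Fintype.card d * ‖p‖) := by
  obtain ⟨c, rfl⟩ := (Submodule.mem_span_image_finset_iff_exists_fun' ℂ).1 hp
  refine (WienerNormLE.sum fun m hm => (WienerNormLE.apply m).smul (c m)).mono ?_
  calc ∑ m ∈ freqCube d N, ‖c m‖ * 1
      ≤ ∑ m ∈ freqCube d N, ‖∑ n ∈ freqCube d N, c n • e n‖ :=
        Finset.sum_le_sum fun m hm => by rw [mul_one]; exact hcoeff _ _ m hm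
    _ = _ := by rw [Finset.sum_const, card_freqCube, nsmul_eq_mul]; push_cast; rfl

/-- Trigonometric polynomials are dense in the Wiener algebra. -/
lemma WienerNormLE.exists_trigPoly {u : A} {C ε : ℝ} (h : WienerNormLE e u C) (hε : 0 < ε) :
    ∃ N, ∃ p ∈ trigPoly e N, WienerNormLE e (u - p) ε := by
  classical
  obtain ⟨b, hb, -, hu⟩ := h
  obtain ⟨s, hs⟩ := ((tendsto_tsum_compl_atTop_zero fun n => ‖b n‖).eventually_lt_const hε).exists
  obtain ⟨N, hN⟩ := exists_finset_subset_freqCube s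
  refine ⟨N, _, sum_mem_trigPoly hN b, ?_⟩
  refine WienerNormLE.of_hasSum (ι := {m // m ∉ s}) (c := fun m => b m) (φ := fun m => m)
    (hb.subtype _) hs.le ?_
  exact (Finset.hasSum_compl_iff (f := fun n => b n • e n) s).2 (by simpa using hu)

/-- The spectral radius of `u` in the Wiener algebra is at most its sup norm. Splitting
`u = p + r` with a trigonometric polynomial `p` and a remainder `r` that is small in the Wiener
norm, the Wiener norm of `p ^ k` exceeds `‖p‖ ^ k` only by a factor polynomial in `k`. -/
lemma WienerNormLE.exists_summable_pow [CompleteSpace A] [NormOneClass A] (he : ∀ m, ‖e m‖ ≤ 1)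
    (hcoeff : ∀ (s : Finset (Multiplicative (d → ℤ))) (c : Multiplicative (d → ℤ) → ℂ),
      ∀ m ∈ s, ‖c m‖ ≤ ‖∑ n ∈ s, c n • e n‖)
    {u : A} {C : ℝ} (h : WienerNormLE e u C) (hu : ‖u‖ < 1) :
    ∃ K : ℕ → ℝ, Summable K ∧ ∀ n, WienerNormLE e (u ^ n) (K n) := by
  -- With `‖p‖ ≤ ‖u‖ + ε`, the binomial expansion of `(p + r) ^ n` is
  -- at most `(‖u‖ + 2 * ε) ^ n`, up to a factor polynomial in `n`.
  set ε := (1 - ‖u‖) / 3 with hε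
  have hε0 : 0 < ε := by rw [hε]; linarith
  obtain ⟨N, p, hp, hr⟩ := h.exists_trigPoly hε0
  set r := u - p with hrdef
  have hpr : u = p + r := by rw [hrdef]; abel
  have hpn : ‖p‖ ≤ ‖u‖ + ε := by
    have h1 : p = u - r := by rw [hrdef]; abel
    rw [h1]
    exact (norm_sub_le _ _).trans (by gcongr; exact hr.norm_le he)
  set ρ := ‖p‖ + ε with hρ
  have hρ0 : 0 ≤ ρ := by positivity
  have hρ1 : ρ < 1 := by rw [hρ]; linarith
  set D := Fintype.card d
  refine ⟨fun n => (2 * (n * N : ℕ) + 1 : ℝ) ^ D * ρ ^ n, ?_, fun n => ?_⟩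
  · have hs := (summable_pow_mul_geometric_of_norm_lt_one D (r := ρ)
      (by rwa [Real.norm_of_nonneg hρ0])).mul_left ((2 * N + 1 : ℝ) ^ D)
    refine Summable.of_norm_bounded_eventually_nat hs ?_
    filter_upwards [Filter.eventually_ge_atTop 1] with n hn
    rw [Real.norm_of_nonneg (by positivity), ← mul_assoc, ← mul_pow]
    gcongr
    push_cast
    have : (1 : ℝ) ≤ n := by exact_mod_cast hn
    nlinarith
  · rw [hpr, add_pow]
    refine (WienerNormLE.sum (C := fun k => (2 * (n * N : ℕ) + 1 : ℝ) ^ D *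
      (‖p‖ ^ k * ε ^ (n - k) * n.choose k)) fun k hk => ?_).mono ?_
    · have hk : k ≤ n := Nat.lt_succ_iff.1 (Finset.mem_range.1 hk)
      have h1 := wienerNormLE_of_mem_trigPoly hcoeff (pow_mem_trigPoly hp k)
      have h2 := ((h1.mul he (hr.pow he (n - k))).smul (n.choose k : ℂ))
      have h3 : p ^ k * r ^ (n - k) * (n.choose k : A) =
          (n.choose k : ℂ) • (p ^ k * r ^ (n - k)) := by
        rw [Nat.cast_smul_eq_nsmul, nsmul_eq_mul, mul_comm]
      rw [h3]
      refine h2.mono ?_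
      rw [Complex.norm_natCast]
      calc _ ≤ (n.choose k : ℝ) *
            ((2 * (n * N : ℕ) + 1) ^ D * ‖p‖ ^ k * ε ^ (n - k)) := by
            gcongr
            exact norm_pow_le p k
        _ = _ := by ring
    · rw [← Finset.mul_sum, ← add_pow]

end TrigPoly

/-! ### The Wiener–Lévy theorem for logarithms on the torus -/

section Torus

open UnitAddTorus

/-- The covering `ℝ^ι → ℝ^d / ℤ^d`. -/
def torusMk (ι : Type*) : C(ι → ℝ, UnitAddTorus ι) where
  toFun x i := (x i : UnitAddCircle)
  continuous_toFun := by fun_prop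

lemma torusMk_apply {ι : Type*} (x : ι → ℝ) (i : ι) : torusMk ι x i = (x i : UnitAddCircle) := rfl

lemma isOpenQuotientMap_torusMk {ι : Type*} : IsOpenQuotientMap (torusMk ι) :=
  IsOpenQuotientMap.piMap fun _ => QuotientAddGroup.isOpenQuotientMap_mk

lemma torusMk_eq_iff {ι : Type*} {x y : ι → ℝ} :
    torusMk ι x = torusMk ι y ↔ ∃ m : ι → ℤ, y = x + fun i => (m i : ℝ) := by
  simp only [torusMk_apply, funext_iff]
  constructor
  · intro h
    have h' : ∀ i, ∃ m : ℤ, y i = x i + m := fun i => by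
      obtain ⟨m, hm⟩ := AddSubgroup.mem_zmultiples_iff.1 (QuotientAddGroup.eq.1 (h i))
      refine ⟨m, ?_⟩
      rw [zsmul_one] at hm
      rw [hm]
      ring
    choose m hm using h'
    exact ⟨m, hm⟩
  · rintro ⟨m, hm⟩ i
    rw [hm i]
    simp

variable {d : Type*} [Fintype d]

/-- The characters `x ↦ exp (2πi ⟨n, x⟩)` of the torus, multiplicatively indexed by `n ∈ ℤ^d`. -/
noncomputable def torusChar (d : Type*) [Fintype d] :
    Multiplicative (d → ℤ) →* C(UnitAddTorus d, ℂ) where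
  toFun n := mFourier n.toAdd
  map_one' := mFourier_zero
  map_mul' m n := by
    ext x
    exact mFourier_add

lemma torusChar_apply (n : Multiplicative (d → ℤ)) : torusChar d n = mFourier n.toAdd := rfl

lemma norm_torusChar (n : Multiplicative (d → ℤ)) : ‖torusChar d n‖ = 1 := mFourier_norm

/-- The circle carries its normalized Haar measure, for which the characters are orthonormal. -/
noncomputable local instance : MeasureSpace UnitAddCircle := ⟨AddCircle.haarAddCircle⟩

local instance : IsProbabilityMeasure (volume : Measure UnitAddCircle) :=
  inferInstanceAs (IsProbabilityMeasure AddCircle.haarAddCircle)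

/-- A Fourier coefficient of a trigonometric polynomial is at most its sup norm. -/
lemma norm_coeff_le_norm_sum_torusChar (s : Finset (Multiplicative (d → ℤ)))
    (c : Multiplicative (d → ℤ) → ℂ) (m : Multiplicative (d → ℤ)) (hm : m ∈ s) :
    ‖c m‖ ≤ ‖∑ n ∈ s, c n • torusChar d n‖ := by
  set L := ContinuousMap.toLp (E := ℂ) 2 (volume : Measure (UnitAddTorus d)) ℂ
  have ho : Orthonormal ℂ fun n : d → ℤ => L (mFourier n) := orthonormal_mFourier
  have ho' : Orthonormal ℂ fun n : Multiplicative (d → ℤ) => L (torusChar d n) :=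
    ho.comp Multiplicative.toAdd Multiplicative.toAdd.injective
  have h1 := ho'.inner_right_sum c hm
  have h2 : ‖L (∑ n ∈ s, c n • torusChar d n)‖ ≤ ‖∑ n ∈ s, c n • torusChar d n‖ := by
    have h3 := (ContinuousMap.toLp_norm_le (E := ℂ) (p := 2) (𝕜 := ℂ)
      (μ := (volume : Measure (UnitAddTorus d))))
    refine (L.le_of_opNorm_le h3 _).trans_eq ?_
    simp [measureUnivNNReal]
  refine le_trans ?_ h2
  rw [map_sum]
  simp only [map_smul]
  rw [← h1]
  refine (norm_inner_le_norm _ _).trans_eq ?_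
  rw [ho'.norm_eq_one m, one_mul]

namespace WienerNormLE

variable {u : C(UnitAddTorus d, ℂ)} {C : ℝ}

/-- The Wiener algebra is closed under the exponential function. -/
lemma exists_exp (h : WienerNormLE (torusChar d) u C) :
    ∃ G D, WienerNormLE (torusChar d) G D ∧ ∀ x, G x = Complex.exp (u x) := by
  have he := fun m => (norm_torusChar (d := d) m).le
  obtain ⟨G, D, hG, hx⟩ := exists_powerSeries he (fun n => ((n.factorial : ℂ))⁻¹)
    (fun n => h.pow he n) (by simpa [div_eq_inv_mul] using Real.summable_pow_div_factorial C)
  refine ⟨G, D, hG, fun x => (ContinuousMap.hasSum_apply hx x).unique ?_⟩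
  have := NormedSpace.expSeries_div_hasSum_exp (u x)
  rw [← Complex.exp_eq_exp_ℂ] at this
  simpa [div_eq_inv_mul] using this

/-- An element of the Wiener algebra at sup distance less than `1` from `1` has a logarithm in the
Wiener algebra. -/
lemma exists_log (h : WienerNormLE (torusChar d) u C) (hu : ‖u‖ < 1) :
    ∃ G D, WienerNormLE (torusChar d) G D ∧ ∀ x, Complex.exp (G x) = 1 - u x := by
  have he := fun m => (norm_torusChar (d := d) m).le
  obtain ⟨K, hK, hW⟩ := h.exists_summable_pow he norm_coeff_le_norm_sum_torusChar hu
  obtain ⟨G, D, hG, hx⟩ := exists_powerSeries he (fun n => (n : ℂ)⁻¹) hW (by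
    refine Summable.of_nonneg_of_le (fun n => mul_nonneg (norm_nonneg _) (hW n).nonneg)
      (fun n => mul_le_of_le_one_left (hW n).nonneg ?_) hK
    rw [norm_inv, Complex.norm_natCast]
    exact Nat.cast_inv_le_one n)
  refine ⟨_, _, hG.smul (-1), fun x => ?_⟩
  have hux : ‖u x‖ < 1 := (u.norm_coe_le_norm x).trans_lt hu
  have h1 := Complex.hasSum_taylorSeries_neg_log hux
  have h2 : HasSum (fun n : ℕ => u x ^ n / n) (G x) := by
    simpa [div_eq_inv_mul] using ContinuousMap.hasSum_apply hx x
  have h3 : 1 - u x ≠ 0 := fun h0 => by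
    rw [← sub_eq_zero.1 h0, norm_one] at hux
    exact lt_irrefl _ hux
  simp [h2.unique h1, Complex.exp_log h3]

end WienerNormLE

/-- A continuous logarithm of the constant function `1` on a connected space is constant. -/
lemma exists_int_of_exp_eq_one {X : Type*} [TopologicalSpace X] [PreconnectedSpace X] [Nonempty X]
    {φ : X → ℂ} (hφ : Continuous φ) (h : ∀ x, Complex.exp (φ x) = 1) :
    ∃ n : ℤ, ∀ x, φ x = n * (2 * Real.pi * Complex.I) := by
  choose n hn using fun x => Complex.exp_eq_one_iff.1 (h x)
  have hc : Continuous n := by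
    rw [Int.isClosedEmbedding_coe_real.isInducing.continuous_iff]
    have h1 : (fun x => ((n x : ℤ) : ℝ)) = fun x => (φ x / (2 * Real.pi * Complex.I)).re := by
      ext x
      rw [hn x, mul_div_cancel_right₀ _ Complex.two_pi_I_ne_zero, Complex.intCast_re]
    change Continuous fun x => ((n x : ℤ) : ℝ)
    rw [h1]
    fun_prop
  obtain ⟨x₀⟩ := ‹Nonempty X›
  exact ⟨n x₀, fun x => by rw [hn x, PreconnectedSpace.constant ‹_› hc (x := x) (y := x₀)]⟩

lemma mFourier_torusMk (n : d → ℤ) (x : d → ℝ) :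
    mFourier n (torusMk d x) = Complex.exp (2 * Real.pi * Complex.I * ∑ i, (n i : ℂ) * x i) := by
  simp only [mFourier, torusMk_apply, ContinuousMap.coe_mk, fourier_coe_apply, Finset.mul_sum,
    Complex.exp_sum]
  refine Finset.prod_congr rfl fun i _ => ?_
  congr 1
  push_cast
  ring

/-- A continuous function without zeros on the torus is homotopic to a character: it is the product
of a character and a continuous exponential. -/
lemma exists_mFourier_mul_exp {F : C(UnitAddTorus d, ℂ)} (hF : ∀ x, F x ≠ 0) :
    ∃ (k : d → ℤ) (h : C(UnitAddTorus d, ℂ)), ∀ x, F x = mFourier k x * Complex.exp (h x) := by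
  classical
  have hq := isOpenQuotientMap_torusMk (ι := d)
  let f : C(d → ℝ, ℂ) := F.comp (torusMk d)
  obtain ⟨H, ⟨-, hH⟩, -⟩ := Complex.isCoveringMapOn_exp.existsUnique_continuousMap_lifts f
    (a₀ := 0) (e₀ := Complex.log (f 0)) (Complex.exp_log (hF _)) (fun x => hF _)
  have hH : ∀ x, Complex.exp (H x) = F (torusMk d x) := fun x => congrFun hH x
  have hper : ∀ m : d → ℤ, ∃ n : ℤ, ∀ x : d → ℝ,
      H (x + fun i => (m i : ℝ)) - H x = n * (2 * Real.pi * Complex.I) := by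
    intro m
    refine exists_int_of_exp_eq_one (φ := fun x : d → ℝ => H (x + fun i => (m i : ℝ)) - H x)
      (by fun_prop) fun x => ?_
    rw [Complex.exp_sub, hH, hH, ← torusMk_eq_iff.2 ⟨m, rfl⟩, div_self (hF _)]
  -- `H` changes along the period `m` by `2πi κ(m)`, where `κ` is additive, hence `κ(m) = ⟨k, m⟩`.
  choose κ hκ using hper
  have hadd : ∀ m n, κ (m + n) = κ m + κ n := by
    intro m n
    have h1 := hκ (m + n) 0
    have h2 := hκ m 0
    have h3 := hκ n (0 + fun i => (m i : ℝ))
    have h4 : (0 : d → ℝ) + (fun i => (m i : ℝ)) + (fun i => (n i : ℝ)) =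
        0 + fun i => ((m + n) i : ℝ) := by ext i; simp
    rw [h4] at h3
    have h5 : ((κ (m + n) : ℤ) : ℂ) = κ m + κ n := by
      apply mul_right_cancel₀ Complex.two_pi_I_ne_zero
      rw [← h1, add_mul, ← h2, ← h3]
      ring
    exact_mod_cast h5
  let κ' : (d → ℤ) →+ ℤ := AddMonoidHom.mk' κ hadd
  let k : d → ℤ := fun i => κ (Pi.single i 1)
  have hk : ∀ m, κ m = ∑ i, k i * m i := by
    intro m
    have h1 : m = ∑ i, m i • (Pi.single i 1 : d → ℤ) := by
      ext j
      simp [Finset.sum_apply, Pi.single_apply]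
    change κ' m = _
    conv_lhs => rw [h1, map_sum]
    exact Finset.sum_congr rfl fun i _ => by rw [map_zsmul, smul_eq_mul, mul_comm]; rfl
  let h₀ : C(d → ℝ, ℂ) :=
    ⟨fun x => H x - 2 * Real.pi * Complex.I * ∑ i, (k i : ℂ) * x i, by fun_prop⟩
  have hdesc : Function.FactorsThrough h₀ (torusMk d) := by
    intro x y hxy
    obtain ⟨m, rfl⟩ := torusMk_eq_iff.1 hxy
    have := hκ m x
    rw [hk] at this
    simp only [h₀, ContinuousMap.coe_mk, Pi.add_apply, Complex.ofReal_add, mul_add,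
      Finset.sum_add_distrib]
    rw [sub_eq_iff_eq_add.1 this]
    push_cast
    ring
  refine ⟨k, hq.isQuotientMap.lift h₀ hdesc, fun y => ?_⟩
  obtain ⟨x, rfl⟩ := hq.surjective y
  have h1 : hq.isQuotientMap.lift h₀ hdesc (torusMk d x) = h₀ x :=
    DFunLike.congr_fun (hq.isQuotientMap.lift_comp h₀ hdesc) x
  rw [h1, mFourier_torusMk, ← Complex.exp_add, ← hH]
  simp [h₀]

/-- **Wiener–Lévy theorem** for the logarithm: a function without zeros in the Wiener algebra of
the torus is the product of a character and the exponential of a function in the Wiener algebra. -/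
theorem WienerNormLE.exists_mFourier_mul_exp {F : C(UnitAddTorus d, ℂ)} {C : ℝ}
    (hW : WienerNormLE (torusChar d) F C) (hF : ∀ x, F x ≠ 0) :
    ∃ (k : d → ℤ) (G : C(UnitAddTorus d, ℂ)) (D : ℝ), WienerNormLE (torusChar d) G D ∧
      ∀ x, F x = mFourier k x * Complex.exp (G x) := by
  have he := fun m => (norm_torusChar (d := d) m).le
  obtain ⟨k, h, hk⟩ := _root_.exists_mFourier_mul_exp hF
  -- A trigonometric polynomial `p` with `|exp (h - p) - 1| < 1` everywhere.
  obtain ⟨p, hp, hhp⟩ : ∃ p ∈ Submodule.span ℂ (Set.range (mFourier (d := d))),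
      dist h p < 1 / 2 := by
    have : h ∈ (Submodule.span ℂ (Set.range (mFourier (d := d)))).topologicalClosure := by
      rw [span_mFourier_closure_eq_top]; trivial
    exact Metric.mem_closure_iff.1 this _ (by norm_num)
  obtain ⟨Cp, hpW⟩ : ∃ Cp, WienerNormLE (torusChar d) p Cp := by
    refine Submodule.span_induction (p := fun p _ => ∃ Cp, WienerNormLE (torusChar d) p Cp)
      ?_ ⟨0, .zero⟩ (fun _ _ _ _ ⟨a, ha⟩ ⟨b, hb⟩ => ⟨_, ha.add hb⟩)
      (fun a _ _ ⟨b, hb⟩ => ⟨_, hb.smul a⟩) hp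
    rintro _ ⟨n, rfl⟩
    exact ⟨1, .apply (Multiplicative.ofAdd n)⟩
  obtain ⟨E, CE, hE, hEx⟩ := (hpW.smul (-1)).exists_exp
  have hchar := WienerNormLE.apply (e := torusChar d) (Multiplicative.ofAdd (-k))
  have hw := (hW.mul he hchar).mul he hE
  set w := F * torusChar d (Multiplicative.ofAdd (-k)) * E
  have hwx : ∀ x, w x = Complex.exp (h x - p x) := by
    intro x
    have h1 : mFourier k x * mFourier (-k) x = 1 := by
      rw [← mFourier_add, add_neg_cancel, mFourier_zero, ContinuousMap.one_apply]
    have h2 : w x = F x * mFourier (-k) x * E x := rfl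
    rw [h2, hk, hEx, Complex.exp_sub, div_eq_mul_inv, ← Complex.exp_neg]
    simp only [neg_smul, one_smul, ContinuousMap.neg_apply]
    linear_combination Complex.exp (h x) * Complex.exp (-p x) * h1
  obtain ⟨q, Cq, hq, hqx⟩ := (WienerNormLE.one.add (hw.smul (-1))).exists_log (by
    rw [ContinuousMap.norm_lt_iff _ one_pos]
    intro x
    have h1 : ‖h x - p x‖ < 1 / 2 := by
      rw [← dist_eq_norm]
      exact (ContinuousMap.dist_apply_le_dist x).trans_lt hhp
    have h2 := Complex.norm_exp_sub_one_le (x := h x - p x) (h1.le.trans (by norm_num))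
    have h3 : (1 + (-1 : ℂ) • w) x = -(Complex.exp (h x - p x) - 1) := by
      rw [← hwx]
      change 1 + (-1) * w x = -(w x - 1)
      ring
    rw [h3, norm_neg]
    linarith)
  refine ⟨k, p + q, _, hpW.add hq, fun x => ?_⟩
  rw [hk x, ContinuousMap.add_apply, Complex.exp_add, hqx]
  simp only [ContinuousMap.add_apply, ContinuousMap.neg_apply, ContinuousMap.one_apply,
    neg_smul, one_smul, hwx, Complex.exp_sub]
  have := Complex.exp_ne_zero (p x)
  field_simp
  ring

end Torus

/-! ### Compound Poisson and infinitely divisible distributions -/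

section InfinitelyDivisible

variable {d : ℕ}

local notation "𝔼" => EuclideanSpace ℝ (Fin d)

lemma integrable_exp_inner {η : Measure 𝔼} [IsFiniteMeasure η] (z : 𝔼) :
    Integrable (fun x => Complex.exp ((⟪x, z⟫ : ℝ) * Complex.I)) η := by
  refine Integrable.of_bound (C := 1) (by fun_prop) (ae_of_all _ fun x => ?_)
  rw [Complex.norm_exp_ofReal_mul_I]

lemma integrable_exp_inner_sub_one {η : Measure 𝔼} [IsFiniteMeasure η] (z : 𝔼) :
    Integrable (fun x => Complex.exp ((⟪z, x⟫ : ℝ) * Complex.I) - 1) η := by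
  simp_rw [real_inner_comm _ z]
  exact (integrable_exp_inner z).sub (integrable_const (1 : ℂ))

lemma integral_exp_inner_sub_one {η : Measure 𝔼} [IsFiniteMeasure η] (z : 𝔼) :
    ∫ x, (Complex.exp ((⟪z, x⟫ : ℝ) * Complex.I) - 1) ∂η = charFun η z - η.real Set.univ := by
  simp_rw [real_inner_comm _ z]
  rw [integral_sub (integrable_exp_inner z) (integrable_const _), charFun_apply]
  simp

instance isFiniteMeasure_convPow (η : Measure 𝔼) [IsFiniteMeasure η] (n : ℕ) :
    IsFiniteMeasure (convPow η n) := by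
  induction n with
  | zero => rw [convPow]; infer_instance
  | succ n ih => rw [convPow]; infer_instance

lemma charFun_convPow (η : Measure 𝔼) [IsFiniteMeasure η] (n : ℕ) (z : 𝔼) :
    charFun (convPow η n) z = charFun η z ^ n := by
  induction n with
  | zero => simp [convPow, charFun_dirac]
  | succ n ih => rw [convPow, charFun_conv, ih, pow_succ]

lemma real_univ_convPow (η : Measure 𝔼) [IsFiniteMeasure η] (n : ℕ) :
    (convPow η n).real Set.univ = η.real Set.univ ^ n := by
  have := charFun_convPow η n 0
  simp only [charFun_zero] at this
  exact_mod_cast this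

/-- For every finite measure `η` there is a compound Poisson distribution with Lévy measure `η`,
namely the Poisson mixture `e^{-λ} ∑ₙ η^{*n} / n!` with `λ = η(ℝ^d)`. -/
lemma exists_charFun_eq_exp_integral (η : Measure 𝔼) [IsFiniteMeasure η] :
    ∃ ρ : Measure 𝔼, IsProbabilityMeasure ρ ∧ ∀ z, charFun ρ z =
      Complex.exp (∫ x, (Complex.exp ((⟪z, x⟫ : ℝ) * Complex.I) - 1) ∂η) := by
  set t := η.real Set.univ with ht
  have ht0 : 0 ≤ t := measureReal_nonneg
  let c : ℕ → ℝ := fun n => Real.exp (-t) / n.factorial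
  have hc : ∀ n, 0 ≤ c n := fun n => by positivity
  have hsum : HasSum (fun n => c n * t ^ n) 1 := by
    have h1 := (NormedSpace.expSeries_div_hasSum_exp t).mul_left (Real.exp (-t))
    rw [← Real.exp_eq_exp_ℝ, ← Real.exp_add, neg_add_cancel, Real.exp_zero] at h1
    have h2 : (fun n => c n * t ^ n) = fun n => Real.exp (-t) * (t ^ n / n.factorial) := by
      ext n
      simp only [c]
      ring
    rwa [h2]
  let ρ : Measure 𝔼 := Measure.sum fun n => ENNReal.ofReal (c n) • convPow η n
  have hρ : IsProbabilityMeasure ρ := by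
    refine ⟨?_⟩
    have h1 : ∀ n, (ENNReal.ofReal (c n) • convPow η n) Set.univ =
        ENNReal.ofReal (c n * t ^ n) := by
      intro n
      rw [Measure.smul_apply, smul_eq_mul, ENNReal.ofReal_mul (hc n), ht, ← real_univ_convPow,
        ofReal_measureReal]
    simp only [ρ, Measure.sum_apply _ MeasurableSet.univ, h1]
    rw [← ENNReal.ofReal_tsum_of_nonneg (fun n => mul_nonneg (hc n) (pow_nonneg ht0 n))
      hsum.summable, hsum.tsum_eq, ENNReal.ofReal_one]
  refine ⟨ρ, hρ, fun z => ?_⟩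
  rw [integral_exp_inner_sub_one, charFun_apply]
  have h1 := hasSum_integral_measure (integrable_exp_inner (η := ρ) z)
  have h2 : ∀ n, ∫ x, Complex.exp ((⟪x, z⟫ : ℝ) * Complex.I) ∂(ENNReal.ofReal (c n) • convPow η n)
      = Complex.exp (-t) * (charFun η z ^ n / n.factorial) := by
    intro n
    rw [integral_smul_measure, ← charFun_apply, charFun_convPow, ENNReal.toReal_ofReal (hc n)]
    simp only [c, Complex.real_smul]
    push_cast
    ring
  simp only [h2] at h1
  have h3 := (NormedSpace.expSeries_div_hasSum_exp (charFun η z)).mul_left (Complex.exp (-t))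
  rw [h1.unique h3, ← Complex.exp_eq_exp_ℂ, ← Complex.exp_add, ← sub_eq_neg_add]

/-- A distribution with finite Lévy measure `η` and drift `a` is infinitely divisible: its `n`-th
root has Lévy measure `η / n` and drift `a / n`. -/
lemma isInfinitelyDivisible_of_charFun_eq {ρ : Measure 𝔼} [IsProbabilityMeasure ρ] (a : 𝔼)
    (η : Measure 𝔼) [IsFiniteMeasure η]
    (hρ : ∀ z, charFun ρ z = Complex.exp ((⟪a, z⟫ : ℝ) * Complex.I +
      ∫ x, (Complex.exp ((⟪z, x⟫ : ℝ) * Complex.I) - 1) ∂η)) :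
    IsInfinitelyDivisible ρ := by
  refine ⟨inferInstance, fun n hn => ?_⟩
  have hn0 : (n : ℂ) ≠ 0 := by exact_mod_cast (Nat.one_le_iff_ne_zero.1 hn)
  obtain ⟨κ, hκ, hκz⟩ := exists_charFun_eq_exp_integral ((n : ℝ≥0)⁻¹ • η)
  refine ⟨(Measure.dirac ((n : ℝ)⁻¹ • a)).conv κ, inferInstance, ?_⟩
  refine Measure.ext_of_charFun (funext fun z => ?_)
  rw [charFun_convPow, charFun_conv, charFun_dirac, hκz, ← Complex.exp_add, ← Complex.exp_nat_mul,
    hρ, integral_smul_nnreal_measure, inner_smul_left]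
  congr 1
  simp only [NNReal.smul_def, Complex.real_smul, NNReal.coe_inv, NNReal.coe_natCast, conj_trivial,
    Complex.ofReal_mul, Complex.ofReal_inv, Complex.ofReal_natCast]
  field_simp

/-- The elementary inequality `1 - |φ(2z)|² ≤ 4 (1 - |φ(z)|²)` for characteristic functions. -/
lemma one_sub_norm_charFun_two_smul_le (ρ : Measure 𝔼) [IsProbabilityMeasure ρ] (z : 𝔼) :
    1 - ‖charFun ρ ((2 : ℝ) • z)‖ ^ 2 ≤ 4 * (1 - ‖charFun ρ z‖ ^ 2) := by
  -- `|φ|²` is the characteristic function of the symmetrization `κ` of `ρ`.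
  set κ := ρ.conv (ρ.map ((-1 : ℝ) • ·)) with hκ
  have : IsProbabilityMeasure (ρ.map ((-1 : ℝ) • ·)) :=
    Measure.isProbabilityMeasure_map (by fun_prop)
  have hφ : ∀ w, ((‖charFun ρ w‖ ^ 2 : ℝ) : ℂ) = charFun κ w := by
    intro w
    rw [hκ, charFun_conv, charFun_map_smul, neg_one_smul, charFun_neg, Complex.mul_conj,
      Complex.normSq_eq_norm_sq]
  have hcos : ∀ w, ‖charFun ρ w‖ ^ 2 = ∫ x, Real.cos ⟪x, w⟫ ∂κ := by
    intro w
    have h1 := congrArg Complex.re (hφ w)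
    rw [Complex.ofReal_re] at h1
    rw [h1, charFun_apply]
    have h2 := (integral_re (integrable_exp_inner (η := κ) w)).symm
    simpa [Complex.exp_ofReal_mul_I_re] using h2
  have hint : ∀ w, Integrable (fun x => Real.cos ⟪x, w⟫) κ := fun w =>
    Integrable.of_bound (C := 1) (by fun_prop) (ae_of_all _ fun x => Real.abs_cos_le_one _)
  have h1 : ∀ w, 1 - ‖charFun ρ w‖ ^ 2 = ∫ x, (1 - Real.cos ⟪x, w⟫) ∂κ := by
    intro w
    rw [integral_sub (integrable_const _) (hint w), ← hcos]
    simp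
  rw [h1, h1, ← integral_const_mul]
  refine integral_mono ((integrable_const _).sub (hint _))
    (((integrable_const _).sub (hint _)).const_mul _) fun x => ?_
  simp only [inner_smul_right, Real.cos_two_mul]
  nlinarith [sq_nonneg (1 - Real.cos ⟪x, z⟫)]

/-- If `φₙ` is the characteristic function of an `n`-th root of `ρ` and `ρ̂(z) ≠ 0`, then
`|φₙ(z)|² → 1`, hence `|φₙ(2z)|² → 1` and `ρ̂(2z) = φₙ(2z)ⁿ ≠ 0` for large `n`. -/
lemma IsInfinitelyDivisible.charFun_two_smul_ne_zero {ρ : Measure 𝔼} (hρ : IsInfinitelyDivisible ρ)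
    {z : 𝔼} (hz : charFun ρ z ≠ 0) : charFun ρ ((2 : ℝ) • z) ≠ 0 := by
  obtain ⟨hprob, hdiv⟩ := hρ
  have hpos : 0 < ‖charFun ρ z‖ ^ 2 := by positivity
  have hlim : Filter.Tendsto (fun n : ℕ => (‖charFun ρ z‖ ^ 2) ^ ((n : ℝ)⁻¹)) Filter.atTop
      (nhds 1) := by
    have h1 : Filter.Tendsto (fun n : ℕ => ((n : ℝ)⁻¹)) Filter.atTop (nhds 0) :=
      tendsto_inv_atTop_nhds_zero_nat
    simpa [Function.comp_def] using (Real.continuousAt_const_rpow (b := 0) hpos.ne').tendsto.comp h1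
  -- `3 / 4` is the threshold: `|φₙ(z)|² > 3 / 4` gives `1 - |φₙ(2z)|² < 1`.
  obtain ⟨n, hn, hn1⟩ := ((hlim.eventually_const_lt (show (3 / 4 : ℝ) < 1 by norm_num)).and
    (Filter.eventually_ge_atTop 1)).exists
  obtain ⟨ρn, hρn, rfl⟩ := hdiv n hn1
  rw [charFun_convPow] at hn ⊢
  refine pow_ne_zero _ fun h0 => ?_
  have h2 := one_sub_norm_charFun_two_smul_le ρn z
  rw [norm_pow, ← pow_mul, mul_comm, pow_mul, Real.pow_rpow_inv_natCast (by positivity)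
    (by omega)] at hn
  rw [h0, norm_zero] at h2
  linarith

/-- The characteristic function of an infinitely divisible distribution has no zeros. -/
theorem IsInfinitelyDivisible.charFun_ne_zero {ρ : Measure 𝔼} (hρ : IsInfinitelyDivisible ρ)
    (z : 𝔼) : charFun ρ z ≠ 0 := by
  have := hρ.1
  have hpow : ∀ (n : ℕ) (w : 𝔼), charFun ρ w ≠ 0 → charFun ρ ((2 : ℝ) ^ n • w) ≠ 0 := by
    intro n w hw
    induction n with
    | zero => simpa using hw
    | succ n ih => rw [pow_succ', mul_smul]; exact hρ.charFun_two_smul_ne_zero ih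
  have hlim : Filter.Tendsto (fun n : ℕ => ((2 : ℝ)⁻¹ ^ n) • z) Filter.atTop (nhds 0) := by
    simpa using (tendsto_pow_atTop_nhds_zero_of_lt_one (by norm_num : (0 : ℝ) ≤ 2⁻¹)
      (by norm_num)).smul_const z
  have hcont : Filter.Tendsto (charFun ρ) (nhds 0) (nhds 1) := by
    have h1 := (continuous_charFun (μ := ρ)).tendsto 0
    simpa [charFun_zero] using h1
  obtain ⟨n, hn⟩ := ((hcont.comp hlim).eventually_ne one_ne_zero).exists
  have := hpow n _ hn
  rwa [smul_smul, ← mul_pow, mul_inv_cancel₀ two_ne_zero, one_pow, one_smul] at this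

end InfinitelyDivisible

/-! ### Discrete signed measures -/

section Discrete

variable {X ι : Type*} [MeasurableSpace X]

/-- A measure carried by a countable set is a sum of point masses. -/
lemma eq_sum_smul_dirac [MeasurableSingletonClass X] [Countable ι] {f : ι → X}
    (hf : Function.Injective f) {μ : Measure X} (hμ : μ (Set.range f)ᶜ = 0) :
    μ = Measure.sum fun i => μ {f i} • Measure.dirac (f i) := by
  ext s hs
  have h1 : s ∩ Set.range f = ⋃ i, s ∩ {f i} := by
    rw [← Set.inter_iUnion, Set.iUnion_singleton_eq_range]
  rw [← measure_inter_conull hμ, h1,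
    measure_iUnion ?_ fun i => hs.inter (measurableSet_singleton _), Measure.sum_apply _ hs]
  · refine tsum_congr fun i => ?_
    rw [Measure.smul_apply, Measure.dirac_apply' _ hs, smul_eq_mul]
    by_cases h : f i ∈ s
    · simp [h]
    · simp [h]
  · intro i j hij
    refine Set.disjoint_left.2 fun x hx hx' => hij (hf ?_)
    rw [← Set.mem_singleton_iff.1 hx.2, Set.mem_singleton_iff.1 hx'.2]

/-- The integral against the difference of two finite measures. -/
lemma integral_toSignedMeasure_sub {μ₁ μ₂ : Measure X} [IsFiniteMeasure μ₁] [IsFiniteMeasure μ₂]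
    {f : X → ℂ} (h₁ : Integrable f μ₁) (h₂ : Integrable f μ₂) :
    ∫ᵛ x, f x ∂<•(μ₁.toSignedMeasure - μ₂.toSignedMeasure) = ∫ x, f x ∂μ₁ - ∫ x, f x ∂μ₂ := by
  rw [VectorMeasure.integral_sub_vectorMeasure, VectorMeasure.integral_toSignedMeasure,
    VectorMeasure.integral_toSignedMeasure]
  · rwa [VectorMeasure.Integrable, Measure.variation_toSignedMeasure]
  · rwa [VectorMeasure.Integrable, Measure.variation_toSignedMeasure]

/-- The signed measure `∑ᵢ βᵢ δ_{xᵢ}` with summable weights. -/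
lemma exists_signedMeasure_hasSum [MeasurableSingletonClass X] [Countable ι] {β : ι → ℝ}
    (hβ : Summable β) (x : ι → X) {S : Set X} (hS : MeasurableSet S) (hxS : ∀ i, β i ≠ 0 → x i ∈ S) :
    ∃ ν : SignedMeasure X, ν.totalVariation Sᶜ = 0 ∧
      ∀ f : X → ℂ, StronglyMeasurable f → (∃ C, ∀ y, ‖f y‖ ≤ C) →
        HasSum (fun i => (β i : ℂ) * f (x i)) (∫ᵛ y, f y ∂<•ν) := by
  have hfin : ∀ {γ : ι → ℝ}, Summable γ → (∀ i, 0 ≤ γ i) →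
      IsFiniteMeasure (Measure.sum fun i => ENNReal.ofReal (γ i) • Measure.dirac (x i)) := by
    intro γ hγ h0
    refine ⟨?_⟩
    simp only [Measure.sum_apply _ MeasurableSet.univ, Measure.smul_apply, measure_univ,
      smul_eq_mul, mul_one]
    rw [← ENNReal.ofReal_tsum_of_nonneg h0 hγ]
    exact ENNReal.ofReal_lt_top
  have hnull : ∀ {γ : ι → ℝ}, (∀ i, γ i ≠ 0 → x i ∈ S) →
      (Measure.sum fun i => ENNReal.ofReal (γ i) • Measure.dirac (x i)) Sᶜ = 0 := by
    intro γ hγ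
    rw [Measure.sum_apply _ hS.compl, ENNReal.tsum_eq_zero]
    intro i
    by_cases h : γ i = 0
    · simp [h]
    · simp [Measure.dirac_apply' _ hS.compl, hγ i h]
  have hp : Summable fun i => β i ⊔ 0 :=
    Summable.of_nonneg_of_le (fun _ => le_sup_right)
      (fun i => sup_le (le_abs_self _) (abs_nonneg _)) hβ.abs
  have hm : Summable fun i => -β i ⊔ 0 :=
    Summable.of_nonneg_of_le (fun _ => le_sup_right) (fun i => sup_le (neg_le_abs _) (abs_nonneg _))
      hβ.abs
  set η₁ := Measure.sum fun i => ENNReal.ofReal (β i ⊔ 0) • Measure.dirac (x i)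
  set η₂ := Measure.sum fun i => ENNReal.ofReal (-β i ⊔ 0) • Measure.dirac (x i)
  have hη₁ : IsFiniteMeasure η₁ := hfin hp fun _ => le_sup_right
  have hη₂ : IsFiniteMeasure η₂ := hfin hm fun _ => le_sup_right
  refine ⟨η₁.toSignedMeasure - η₂.toSignedMeasure, ?_, fun f hf hb => ?_⟩
  · rw [SignedMeasure.totalVariation_eq_variation]
    refine le_antisymm ((VectorMeasure.variation_sub_le _).trans_eq ?_) zero_le
    rw [Measure.variation_toSignedMeasure, Measure.variation_toSignedMeasure, Measure.add_apply,
      hnull (fun i hi => hxS i fun h => hi (by simp [h])),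
      hnull (fun i hi => hxS i fun h => hi (by simp [h])), add_zero]
  · obtain ⟨C, hC⟩ := hb
    have hi : ∀ (η : Measure X) [IsFiniteMeasure η], Integrable f η := fun η _ =>
      Integrable.of_bound hf.aestronglyMeasurable C (ae_of_all _ hC)
    rw [integral_toSignedMeasure_sub (hi η₁) (hi η₂)]
    have h1 := (hasSum_integral_measure (hi η₁)).sub (hasSum_integral_measure (hi η₂))
    refine h1.congr_fun fun i => Eq.symm ?_
    rw [integral_smul_measure, integral_smul_measure, integral_dirac,
      ENNReal.toReal_ofReal le_sup_right, ENNReal.toReal_ofReal le_sup_right, ← sub_smul,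
      Complex.real_smul, max_zero_sub_max_neg_zero_eq_self]

end Discrete

/-! ### Distributions on the lattice -/

section Lattice

open UnitAddTorus

variable {d : ℕ}

local notation "𝔼" => EuclideanSpace ℝ (Fin d)

lemma intVec_injective : Function.Injective (intVec (d := d)) := by
  intro m n h
  ext i
  have := congrArg (fun v : 𝔼 => v i) h
  simpa [intVec] using this

lemma measurableSet_intLattice_diff : MeasurableSet (intLattice d \ {0}) :=
  (Set.countable_range _).measurableSet.diff (measurableSet_singleton 0)

lemma intVec_zero : intVec (0 : Fin d → ℤ) = 0 := by
  ext i
  simp [intVec]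

lemma intVec_mem_diff {n : Fin d → ℤ} (hn : n ≠ 0) : intVec n ∈ intLattice d \ {0} :=
  ⟨⟨n, rfl⟩, fun h => hn (intVec_injective (h.trans intVec_zero.symm))⟩

/-- The character `z ↦ exp (i ⟨n, z⟩)` is the pullback of a character of `ℝ^d / ℤ^d` under
`z ↦ z / (2π)`. -/
lemma mFourier_torusMk_div (n : Fin d → ℤ) (z : 𝔼) :
    mFourier n (torusMk (Fin d) fun i => z i / (2 * Real.pi)) =
      Complex.exp ((⟪intVec n, z⟫ : ℝ) * Complex.I) := by
  rw [mFourier_torusMk]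
  congr 1
  simp only [intVec, PiLp.inner_apply, Finset.mul_sum, Complex.ofReal_sum, Finset.sum_mul]
  refine Finset.sum_congr rfl fun i _ => ?_
  have : (Real.pi : ℂ) ≠ 0 := by exact_mod_cast Real.pi_ne_zero
  simp
  field_simp

/-- The characteristic function of a distribution on `ℤ^d` is an absolutely convergent Fourier
series. -/
lemma exists_wienerNormLE_charFun {μ : Measure 𝔼} [IsProbabilityMeasure μ]
    (hμ : μ (intLattice d)ᶜ = 0) :
    ∃ F C, WienerNormLE (torusChar (Fin d)) F C ∧
      ∀ z : 𝔼, F (torusMk (Fin d) fun i => z i / (2 * Real.pi)) = charFun μ z := by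
  have hsum := eq_sum_smul_dirac intVec_injective hμ
  have hS : Summable fun n : Multiplicative (Fin d → ℤ) => ‖(μ.real {intVec n.toAdd} : ℂ)‖ := by
    have h1 : Summable fun n : Fin d → ℤ => μ.real {intVec n} := by
      refine ENNReal.summable_toReal ?_
      rw [← measure_iUnion (fun i j hij => Set.disjoint_singleton.2 (intVec_injective.ne hij))
        fun i => measurableSet_singleton _]
      exact measure_ne_top _ _
    refine (Multiplicative.toAdd.summable_iff (f := fun n : Fin d → ℤ => μ.real {intVec n})).2 h1
      |>.congr fun n => ?_
    rw [Complex.norm_real, Real.norm_of_nonneg measureReal_nonneg]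
    rfl
  have hF : Summable fun n : Multiplicative (Fin d → ℤ) =>
      (μ.real {intVec n.toAdd} : ℂ) • torusChar (Fin d) n :=
    Summable.of_norm_bounded hS fun n =>
      WienerNormLE.norm_smul_le (fun m => (norm_torusChar m).le) _ _
  refine ⟨_, _, ⟨_, hS, le_rfl, hF.hasSum⟩, fun z => ?_⟩
  have h1 := ContinuousMap.hasSum_apply hF.hasSum (torusMk (Fin d) fun i => z i / (2 * Real.pi))
  have h2 := integrable_exp_inner (η := μ) z
  rw [hsum] at h2
  have h3 := hasSum_integral_measure h2
  rw [← hsum, ← charFun_apply] at h3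
  refine h1.unique (((Multiplicative.toAdd.hasSum_iff (f := fun n : Fin d → ℤ =>
    ∫ x, Complex.exp ((⟪x, z⟫ : ℝ) * Complex.I) ∂(μ {intVec n} • Measure.dirac (intVec n)))).2
      h3).congr_fun fun n => ?_)
  rw [ContinuousMap.smul_apply, torusChar_apply, mFourier_torusMk_div]
  simp [integral_smul_measure, measureReal_def]

/-- Without zeros, the characteristic function of a distribution on `ℤ^d` is a character times the
exponential of an absolutely convergent Fourier series. Replacing the coefficients by their
real parts replaces the exponential by its geometric mean with its reflected conjugate, and hence
keeps the identity up to a sign, which is determined at `z = 0`. -/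
lemma exists_charFun_eq_exp_tsum {μ : Measure 𝔼} [IsProbabilityMeasure μ]
    (hμ : μ (intLattice d)ᶜ = 0) (hne : ∀ z, charFun μ z ≠ 0) :
    ∃ (k : Fin d → ℤ) (β : (Fin d → ℤ) → ℝ), Summable β ∧ ∀ z : 𝔼, ∃ s : ℂ,
      HasSum (fun n => (β n : ℂ) * (Complex.exp ((⟪intVec n, z⟫ : ℝ) * Complex.I) - 1)) s ∧
      charFun μ z = Complex.exp (Complex.I * (⟪intVec k, z⟫ : ℝ) + s) := by
  obtain ⟨F, C, hF, hFμ⟩ := exists_wienerNormLE_charFun hμ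
  have hF0 : ∀ x, F x ≠ 0 := by
    intro x
    obtain ⟨y, rfl⟩ := isOpenQuotientMap_torusMk.surjective x
    have h1 := hFμ (WithLp.toLp 2 fun i => y i * (2 * Real.pi))
    have h2 : (fun i => (WithLp.toLp 2 fun i => y i * (2 * Real.pi) : 𝔼) i / (2 * Real.pi)) =
        y := by
      ext i
      have := Real.pi_ne_zero
      simp
    rw [h2] at h1
    rw [h1]
    exact hne _
  obtain ⟨k, G, D, ⟨b, hb, -, hG⟩, hFG⟩ := hF.exists_mFourier_mul_exp hF0
  let τ : 𝔼 → UnitAddTorus (Fin d) := fun z => torusMk (Fin d) fun i => z i / (2 * Real.pi)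
  have hτ : Continuous τ := by fun_prop
  let e : (Fin d → ℤ) → 𝔼 → ℂ := fun n z => Complex.exp ((⟪intVec n, z⟫ : ℝ) * Complex.I)
  have he_conj : ∀ n z, starRingEnd ℂ (e n (-z)) = e n z := by
    intro n z
    simp only [e, ← Complex.exp_conj, map_mul, Complex.conj_I,
      inner_neg_right, Complex.ofReal_neg, map_neg, neg_mul_neg, Complex.conj_ofReal]
  have he_zero : ∀ n, e n 0 = 1 := by simp [e]
  let g : 𝔼 → ℂ := fun z => G (τ z)
  have hg : Continuous g := G.continuous.comp hτ
  let c : (Fin d → ℤ) → ℂ := fun n => b (Multiplicative.ofAdd n)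
  have hc : Summable fun n => ‖c n‖ := Multiplicative.ofAdd.summable_iff.2 hb
  have hgs : ∀ z, HasSum (fun n => c n * e n z) (g z) := by
    intro z
    refine (Multiplicative.toAdd.hasSum_iff (f := fun n => c n * e n z)).1
      ((ContinuousMap.hasSum_apply hG (τ z)).congr_fun fun n => Eq.symm ?_)
    rw [ContinuousMap.smul_apply, torusChar_apply, mFourier_torusMk_div]
    rfl
  have hμg : ∀ z, charFun μ z = e k z * Complex.exp (g z) := by
    intro z
    rw [← hFμ z, hFG, mFourier_torusMk_div]
  let r : 𝔼 → ℂ := fun z => (g z + starRingEnd ℂ (g (-z))) / 2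
  have hr : Continuous r := by
    have := Complex.continuous_conj
    fun_prop
  have hrs : ∀ z, HasSum (fun n => ((c n).re : ℂ) * e n z) (r z) := by
    intro z
    have h1 := (((hgs z).add ((hgs (-z)).map (starRingEnd ℂ) Complex.continuous_conj)).div_const 2)
    refine h1.congr_fun fun n => Eq.symm ?_
    simp only [Function.comp_apply, map_mul, he_conj, Complex.re_eq_add_conj]
    ring
  have hr0 : r 0 = ((∑' n, (c n).re : ℝ) : ℂ) := by
    rw [← (hrs 0).tsum_eq, Complex.ofReal_tsum]
    simp [he_zero]
  have hsq : ∀ z, charFun μ z ^ 2 = (e k z * Complex.exp (r z)) ^ 2 := by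
    intro z
    have h1 : charFun μ z = e k z * Complex.exp (starRingEnd ℂ (g (-z))) := by
      have := charFun_neg (μ := μ) (-z)
      rw [neg_neg, hμg (-z), map_mul, he_conj, ← Complex.exp_conj] at this
      exact this
    calc charFun μ z ^ 2 = charFun μ z * charFun μ z := sq _
      _ = (e k z * Complex.exp (g z)) * (e k z * Complex.exp (starRingEnd ℂ (g (-z)))) := by
        rw [← hμg, ← h1]
      _ = e k z ^ 2 * Complex.exp (2 * r z) := by
        rw [show 2 * r z = g z + starRingEnd ℂ (g (-z)) by simp only [r]; ring, Complex.exp_add]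
        ring
      _ = (e k z * Complex.exp (r z)) ^ 2 := by
        rw [mul_pow, two_mul, Complex.exp_add, sq (Complex.exp (r z))]
  have hμ0 : charFun μ 0 = 1 := by simp [charFun_zero]
  have hek : Continuous (e k) := by fun_prop
  have hμr : ∀ z, charFun μ z = e k z * Complex.exp (r z) := by
    rcases (isPreconnected_univ (α := 𝔼)).eq_or_eq_neg_of_sq_eq
      (f := charFun μ) (g := fun z => e k z * Complex.exp (r z))
      continuous_charFun.continuousOn (hek.mul hr.cexp).continuousOn (fun z _ => hsq z)
      (fun {z} _ => mul_ne_zero (Complex.exp_ne_zero _) (Complex.exp_ne_zero _)) with h | h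
    · exact fun z => h (Set.mem_univ z)
    · exfalso
      have h1 := h (Set.mem_univ 0)
      rw [hμ0, Pi.neg_apply, he_zero, hr0, one_mul, ← Complex.ofReal_exp] at h1
      have h2 : (1 : ℝ) = -Real.exp (∑' n, (c n).re) := by exact_mod_cast h1
      linarith [Real.exp_pos (∑' n, (c n).re)]
  have hr00 : r 0 = 0 := by
    have h1 := hμr 0
    rw [hμ0, he_zero, one_mul, hr0, ← Complex.ofReal_exp] at h1
    have h2 : Real.exp (∑' n, (c n).re) = 1 := by exact_mod_cast h1.symm
    rw [hr0, Real.exp_eq_one_iff _ |>.1 h2, Complex.ofReal_zero]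
  refine ⟨k, fun n => (c n).re, (Complex.hasSum_re hc.of_norm.hasSum).summable, fun z =>
    ⟨r z, ?_, ?_⟩⟩
  · have h1 := (hrs z).sub (hrs 0)
    rw [hr00, sub_zero] at h1
    refine h1.congr_fun fun n => Eq.symm ?_
    rw [he_zero, mul_sub]
  · rw [hμr, Complex.exp_add, mul_comm Complex.I]

/-- The Lévy–Khintchine representation with a signed Lévy measure. -/
theorem exists_signedMeasure_charFun_eq {μ : Measure 𝔼} [IsProbabilityMeasure μ]
    (hμ : μ (intLattice d)ᶜ = 0) (hne : ∀ z, charFun μ z ≠ 0) :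
    ∃ (k : Fin d → ℤ) (ν : SignedMeasure 𝔼), ν.totalVariation (intLattice d \ {0})ᶜ = 0 ∧
      ∀ z : 𝔼, charFun μ z = Complex.exp (Complex.I * (⟪intVec k, z⟫ : ℝ) +
        ∫ᵛ x, (Complex.exp ((⟪z, x⟫ : ℝ) * Complex.I) - 1) ∂<•ν) := by
  obtain ⟨k, β, hβ, hμβ⟩ := exists_charFun_eq_exp_tsum hμ hne
  -- The weight at `0` is irrelevant, because `exp (i ⟨z, 0⟩) - 1 = 0`.
  have hβ' : Summable (Function.update β 0 0) :=
    (hβ.hasSum.update 0 0).summable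
  obtain ⟨ν, hν, hint⟩ := exists_signedMeasure_hasSum hβ' (intVec (d := d))
    measurableSet_intLattice_diff (fun n hn => intVec_mem_diff fun h0 => hn (by simp [h0]))
  refine ⟨k, ν, hν, fun z => ?_⟩
  obtain ⟨s, hs, hz⟩ := hμβ z
  have h1 := hint (fun x => Complex.exp ((⟪z, x⟫ : ℝ) * Complex.I) - 1)
    (by fun_prop) ⟨2, fun x => ?_⟩
  · rw [hz, h1.unique (hs.congr_fun fun n => Eq.symm ?_)]
    rcases eq_or_ne n 0 with rfl | hn
    · simp [intVec_zero]
    · simp [hn, real_inner_comm]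
  · refine (norm_sub_le _ _).trans_eq ?_
    rw [Complex.norm_exp_ofReal_mul_I, norm_one]
    norm_num

/-- A nonzero finite measure on `ℤ^d ∖ {0}` is the Lévy measure of a compound Poisson distribution
with jumps in `ℤ^d ∖ {0}`. -/
lemma exists_isCompoundPoisson (η : Measure 𝔼) [IsFiniteMeasure η] (hη0 : η ≠ 0)
    (hη : η (intLattice d \ {0})ᶜ = 0) :
    ∃ ρ σ : Measure 𝔼, IsCompoundPoisson ρ σ ∧ σ (intLattice d \ {0})ᶜ = 0 ∧
      ∀ z, charFun ρ z = Complex.exp (∫ x, (Complex.exp ((⟪z, x⟫ : ℝ) * Complex.I) - 1) ∂η) := by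
  obtain ⟨ρ, hρ, hρz⟩ := exists_charFun_eq_exp_integral η
  set t : ℝ≥0 := (η Set.univ).toNNReal with ht
  have ht' : (t : ℝ≥0∞) = η Set.univ := ENNReal.coe_toNNReal (measure_ne_top _ _)
  have ht0 : t ≠ 0 := by
    rw [← ENNReal.coe_ne_zero, ht']
    exact Measure.measure_univ_ne_zero.2 hη0
  have hσ : (t⁻¹ • η) (intLattice d \ {0})ᶜ = 0 := by simp [hη]
  refine ⟨ρ, t⁻¹ • η, ⟨hρ, ⟨?_⟩, measure_mono_null (by simp) hσ, t, pos_iff_ne_zero.2 ht0, ?_⟩, hσ,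
    hρz⟩
  · rw [Measure.smul_apply, ENNReal.smul_def, ← ht', smul_eq_mul, ← ENNReal.coe_mul,
      inv_mul_cancel₀ ht0, ENNReal.coe_one]
  · rw [smul_smul, mul_inv_cancel₀ ht0, one_smul]
    exact hρz

/-- A signed Lévy measure splits into its positive and its negative part. The point mass `δ` added
to both makes them nonzero, as jump rates have to be positive. -/
lemma exists_isCompoundPoisson_quotient (hd : 1 ≤ d) {ν : SignedMeasure 𝔼}
    (hν : ν.totalVariation (intLattice d \ {0})ᶜ = 0) :
    ∃ μ₁ μ₂ σ₁ σ₂ : Measure 𝔼, IsCompoundPoisson μ₁ σ₁ ∧ IsCompoundPoisson μ₂ σ₂ ∧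
      σ₁ (intLattice d \ {0})ᶜ = 0 ∧ σ₂ (intLattice d \ {0})ᶜ = 0 ∧
      ∀ z : 𝔼, Complex.exp (∫ᵛ x, (Complex.exp ((⟪z, x⟫ : ℝ) * Complex.I) - 1) ∂<•ν) =
        charFun μ₁ z / charFun μ₂ z := by
  set j := ν.toJordanDecomposition with hj
  have hνj : j.posPart.toSignedMeasure - j.negPart.toSignedMeasure = ν :=
    ν.toSignedMeasure_toJordanDecomposition
  have hpos : j.posPart (intLattice d \ {0})ᶜ = 0 ∧ j.negPart (intLattice d \ {0})ᶜ = 0 := by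
    rwa [SignedMeasure.totalVariation, Measure.add_apply, add_eq_zero] at hν
  let δ : Measure 𝔼 := Measure.dirac (intVec fun _ => 1)
  have hδ : δ (intLattice d \ {0})ᶜ = 0 := by
    rw [Measure.dirac_apply' _ measurableSet_intLattice_diff.compl]
    have h1 : (fun _ : Fin d => (1 : ℤ)) ≠ 0 := fun h => one_ne_zero (congrFun h ⟨0, hd⟩)
    simp [intVec_mem_diff h1]
  have hne : ∀ η : Measure 𝔼, η + δ ≠ 0 := by
    intro η h
    have := congrArg (fun m : Measure 𝔼 => m Set.univ) h
    simp [δ] at this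
  obtain ⟨μ₁, σ₁, h₁, hσ₁, hz₁⟩ := exists_isCompoundPoisson (j.posPart + δ) (hne _)
    (by rw [Measure.add_apply, hpos.1, hδ, add_zero])
  obtain ⟨μ₂, σ₂, h₂, hσ₂, hz₂⟩ := exists_isCompoundPoisson (j.negPart + δ) (hne _)
    (by rw [Measure.add_apply, hpos.2, hδ, add_zero])
  refine ⟨μ₁, μ₂, σ₁, σ₂, h₁, h₂, hσ₁, hσ₂, fun z => ?_⟩
  have hi := fun (η : Measure 𝔼) (_ : IsFiniteMeasure η) => integrable_exp_inner_sub_one (η := η) z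
  rw [hz₁, hz₂, ← Complex.exp_sub, integral_add_measure (hi _ inferInstance) (hi _ inferInstance),
    integral_add_measure (hi _ inferInstance) (hi _ inferInstance), add_sub_add_right_eq_sub,
    ← integral_toSignedMeasure_sub (hi _ inferInstance) (hi _ inferInstance), hνj]

lemma IsCompoundPoisson.exists_charFun_eq {ρ σ : Measure 𝔼} (h : IsCompoundPoisson ρ σ) :
    ∃ η : Measure 𝔼, IsFiniteMeasure η ∧ ∀ z, charFun ρ z =
      Complex.exp (∫ x, (Complex.exp ((⟪z, x⟫ : ℝ) * Complex.I) - 1) ∂η) := by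
  obtain ⟨-, hσ, -, r, -, hz⟩ := h
  exact ⟨r • σ, inferInstance, hz⟩

end Lattice

/-- For a probability distribution `μ` on `ℤ^d`, `d ≥ 1`: the characteristic function has no zeros
iff it has a Lévy–Khintchine type representation with integer drift and a finite signed measure on
`ℤ^d ∖ {0}`, iff it is a shift times a quotient of two compound Poisson characteristic functions
with jumps in `ℤ^d ∖ {0}`, iff it is a quotient of two infinitely divisible ones. The integral
`∫ᵛ x, f x ∂<•ν` is the integral of `f` with respect to the signed measure `ν`. -/
theorem theorem3p2 (d : ℕ) (hd : 1 ≤ d) (μ : Measure (EuclideanSpace ℝ (Fin d)))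
    (hμ : IsProbabilityMeasure μ) (hμZ : μ (intLattice d)ᶜ = 0) :
    List.TFAE
      [ ∀ z : EuclideanSpace ℝ (Fin d), charFun μ z ≠ 0,
        ∃ (k : Fin d → ℤ) (ν : SignedMeasure (EuclideanSpace ℝ (Fin d))),
          ν.totalVariation (intLattice d \ {0})ᶜ = 0 ∧
          ∀ z : EuclideanSpace ℝ (Fin d),
            charFun μ z =
              Complex.exp (Complex.I * (⟪intVec k, z⟫ : ℝ) +
                ∫ᵛ x, (Complex.exp ((⟪z, x⟫ : ℝ) * Complex.I) - 1) ∂<•ν),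
        ∃ (k : Fin d → ℤ) (μ₁ μ₂ σ₁ σ₂ : Measure (EuclideanSpace ℝ (Fin d))),
          IsCompoundPoisson μ₁ σ₁ ∧ IsCompoundPoisson μ₂ σ₂ ∧
          σ₁ (intLattice d \ {0})ᶜ = 0 ∧ σ₂ (intLattice d \ {0})ᶜ = 0 ∧
          ∀ z : EuclideanSpace ℝ (Fin d),
            charFun μ z =
              Complex.exp (Complex.I * (⟪intVec k, z⟫ : ℝ)) * (charFun μ₁ z / charFun μ₂ z),
        ∃ μ₃ μ₄ : Measure (EuclideanSpace ℝ (Fin d)),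
          IsInfinitelyDivisible μ₃ ∧ IsInfinitelyDivisible μ₄ ∧
          ∀ z : EuclideanSpace ℝ (Fin d), charFun μ z = charFun μ₃ z / charFun μ₄ z ] ∧
    (IsQuasiInfinitelyDivisible μ ↔ ∀ z : EuclideanSpace ℝ (Fin d), charFun μ z ≠ 0) := by
  have hquot : (∃ μ₃ μ₄ : Measure (EuclideanSpace ℝ (Fin d)),
      IsInfinitelyDivisible μ₃ ∧ IsInfinitelyDivisible μ₄ ∧
      ∀ z : EuclideanSpace ℝ (Fin d), charFun μ z = charFun μ₃ z / charFun μ₄ z) →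
      ∀ z : EuclideanSpace ℝ (Fin d), charFun μ z ≠ 0 := by
    rintro ⟨μ₃, μ₄, h₃, h₄, h⟩ z
    rw [h]
    exact div_ne_zero (h₃.charFun_ne_zero z) (h₄.charFun_ne_zero z)
  rw [and_iff_left_of_imp fun h => ⟨fun hq => hquot hq.2, fun h0 => ⟨hμ, (h.out 0 3).1 h0⟩⟩]
  tfae_have 1 → 2 := fun h => exists_signedMeasure_charFun_eq hμZ h
  tfae_have 2 → 3 := by
    rintro ⟨k, ν, hν, h⟩
    obtain ⟨μ₁, μ₂, σ₁, σ₂, h₁, h₂, hσ₁, hσ₂, hz⟩ := exists_isCompoundPoisson_quotient hd hν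
    refine ⟨k, μ₁, μ₂, σ₁, σ₂, h₁, h₂, hσ₁, hσ₂, fun z => ?_⟩
    rw [h, Complex.exp_add, hz]
  tfae_have 3 → 4 := by
    rintro ⟨k, μ₁, μ₂, σ₁, σ₂, h₁, h₂, -, -, h⟩
    have hμ₁ := h₁.1
    have hμ₂ := h₂.1
    obtain ⟨η₁, hη₁, hz₁⟩ := h₁.exists_charFun_eq
    obtain ⟨η₂, hη₂, hz₂⟩ := h₂.exists_charFun_eq
    have hshift : ∀ z, charFun ((Measure.dirac (intVec k)).conv μ₁) z =
        Complex.exp ((⟪intVec k, z⟫ : ℝ) * Complex.I) * charFun μ₁ z := fun z => by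
      rw [charFun_conv, charFun_dirac]
    refine ⟨(Measure.dirac (intVec k)).conv μ₁, μ₂,
      isInfinitelyDivisible_of_charFun_eq (intVec k) η₁ fun z => ?_,
      isInfinitelyDivisible_of_charFun_eq 0 η₂ fun z => ?_, fun z => ?_⟩
    · rw [hshift, hz₁, Complex.exp_add]
    · rw [hz₂]
      simp
    · rw [h, hshift, mul_comm Complex.I, mul_div_assoc]
  tfae_have 4 → 1 := hquot
  tfae_finish
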